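/- All matrices are complex; $\mathcal M_d$ denotes the $d\times d$ matrices, $A\le B$ means that $B-A$ is positive semidefinite, and $A$ is strictly positive ($A>0$) if it is positive semidefinite and invertible. A weight vector is a finite family $\omega=(\omega_j)_{j\in J}$ of real numbers with $\omega_j\ge 0$ and $\sum_{j\in J}\omega_j=1$. For $X,A>0$ let $X\,\sharp_t\,A=X^{1/2}\,(X^{-1/2}AX^{-1/2})^{t}\,X^{1/2}$. For a weight vector $\omega$ and a family $\mathbb A=(A_j)_{j\in J}$ of strictly positive matrices of the same size, the matrix power mean $P_t(\omega;\mathbb A)$ is, for $t\in(0,1]$, the unique strictly positive solution $X$ of $X=\sum_{j\in J}\omega_j\,(X\,\sharp_t\,A_j)$, and, for $t\in[-1,0)$, $P_t(\omega;\mathbb A):=P_{-t}(\omega;(A_j^{-1})_{j\in J})^{-1}$. Let $\Phi:\mathcal M_q^{\,n}\to\mathcal M_p$ be a map that is linear in each variable, positive ($\Phi(A_1,\dots,A_n)\ge 0$ whenever $A_1,\dots,A_n\ge 0$) and unital ($\Phi(I,\dots,I)=I$). For $i=1,\dots,n$ let $\omega^{(i)}=(\omega^{(i)}_1,\dots,\omega^{(i)}_k)$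 be a weight vector and $\mathbb A^{(i)}=(A^{(i)}_1,\dots,A^{(i)}_k)$ a $k$-tuple of strictly positive matrices in $\mathcal M_q$. Define, as families indexed by all multi-indices $(j_1,\dots,j_n)\in\{1,\dots,k\}^n$, \[ \omega^{(1)}\cdots\omega^{(n)}:=\Bigl(\omega^{(1)}_{j_1}\cdots\omega^{(n)}_{j_n}\Bigr)_{(j_1,\dots,j_n)},\qquad \Phi(\mathbb A^{(1)},\dots,\mathbb A^{(n)}):=\Bigl(\Phi(A^{(1)}_{j_1},\dots,A^{(n)}_{j_n})\Bigr)_{(j_1,\dots,j_n)} . \] (1) If $t\in(0,1]$, then \[ \Phi\bigl(P_t(\omega^{(1)};\mathbb A^{(1)}),\dots,P_t(\omega^{(n)};\mathbb A^{(n)})\bigr)\le P_t\bigl(\omega^{(1)}\cdots\omega^{(n)};\Phi(\mathbb A^{(1)},\dots,\mathbb A^{(n)})\bigr). \] (2) If $t\in[-1,0)$ and $mI\le A^{(i)}_j\le MI$ for all $i=1,\dots,n$ and $j=1,\dots,k$, with scalars $0<m<M$, then \[ P_t\bigl(\omega^{(1)}\cdots\omega^{(n)};\Phi(\mathbb A^{(1)},\dots,\mathbb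 A^{(n)})\bigr)\le\frac{(M^n+m^n)^2}{4M^nm^n}\,\Phi\bigl(P_t(\omega^{(1)};\mathbb A^{(1)}),\dots,P_t(\omega^{(n)};\mathbb A^{(n)})\bigr). \] -/

import Mathlib

open scoped MatrixOrder ComplexOrder

noncomputable section

/-- The algebra of complex `d × d` matrices. With the order of `MatrixOrder`, `A ≤ B` means that
`B - A` is positive semidefinite. -/
abbrev CMat (d : ℕ) : Type := Matrix (Fin d) (Fin d) ℂ

/-- The weighted geometric mean
`X ♯_t A = X^(1/2) (X^(-1/2) A X^(-1/2))^t X^(1/2)` of strictly positive matrices; the real powers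
are those of the continuous functional calculus. -/
def geomMean {d : ℕ} (t : ℝ) (X A : CMat d) : CMat d :=
  X ^ (1 / 2 : ℝ) * (X ^ (-(1 / 2) : ℝ) * A * X ^ (-(1 / 2) : ℝ)) ^ t * X ^ (1 / 2 : ℝ)

/-- `ω` is a weight vector: nonnegative entries with sum one. -/
def IsWeight {ι : Type*} [Fintype ι] (ω : ι → ℝ) : Prop :=
  (∀ i, 0 ≤ ω i) ∧ ∑ i, ω i = 1

/-- `X` is a strictly positive solution of the equation `X = ∑ i, ω i (X ♯_t A i)`. -/
def IsPowerMeanSolution {d : ℕ} {ι : Type*} [Fintype ι] (t : ℝ) (ω : ι → ℝ) (A : ι → CMat d)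
    (X : CMat d) : Prop :=
  X.PosDef ∧ X = ∑ i, ω i • geomMean t X (A i)

open Classical in
/-- The matrix power mean for an exponent in `(0, 1]`: the strictly positive solution of the
defining equation. (It exists and is unique for a weight vector and strictly positive matrices;
the value `0` is only there to make the function total.) -/
def powerMeanPos {d : ℕ} {ι : Type*} [Fintype ι] (t : ℝ) (ω : ι → ℝ) (A : ι → CMat d) : CMat d :=
  if h : ∃ X, IsPowerMeanSolution t ω A X then h.choose else 0

/-- The matrix power mean `P_t(ω; A)` for `t ∈ [-1, 0) ∪ (0, 1]`, where for negative `t` one sets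
`P_t(ω; A) = P_{-t}(ω; A⁻¹)⁻¹`. (Not meant to be used outside this range of `t`.) -/
def powerMean {d : ℕ} {ι : Type*} [Fintype ι] (t : ℝ) (ω : ι → ℝ) (A : ι → CMat d) : CMat d :=
  if 0 < t then powerMeanPos t ω A
  else (powerMeanPos (-t) ω (fun i => (A i)⁻¹))⁻¹

/-- A multilinear mapping is positive if it maps positive matrices to positive matrices. -/
def IsPositiveMultilinear {n q p : ℕ}
    (Φ : MultilinearMap ℂ (fun _ : Fin n => CMat q) (CMat p)) : Prop :=
  ∀ A : Fin n → CMat q, (∀ i, (A i).PosSemidef) → (Φ A).PosSemidef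

/-- A multilinear mapping is unital if `Φ(I, …, I) = I`. -/
def IsUnitalMultilinear {n q p : ℕ}
    (Φ : MultilinearMap ℂ (fun _ : Fin n => CMat q) (CMat p)) : Prop :=
  Φ (fun _ => 1) = 1

/-- The product `ω⁽¹⁾ ⋯ ω⁽ⁿ⁾` of weight vectors of length `k`, indexed by all multi-indices
`j = (j₁, …, jₙ)`: its entry at `j` is `ω⁽¹⁾_{j₁} ⋯ ω⁽ⁿ⁾_{jₙ}`. -/
def prodWeight {n k : ℕ} (ω : Fin n → Fin k → ℝ) : (Fin n → Fin k) → ℝ :=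
  fun j => ∏ i, ω i (j i)

/-- The tuple `Φ(𝔸⁽¹⁾, …, 𝔸⁽ⁿ⁾)`, indexed by all multi-indices `j = (j₁, …, jₙ)`: its entry at `j`
is `Φ(A⁽¹⁾_{j₁}, …, A⁽ⁿ⁾_{jₙ})`. -/
def mapTuple {n k q p : ℕ} (Φ : MultilinearMap ℂ (fun _ : Fin n => CMat q) (CMat p))
    (A : Fin n → Fin k → CMat q) : (Fin n → Fin k) → CMat p :=
  fun j => Φ (fun i => A i (j i))

end

/-!
A positive unital multilinear map `Φ` is handled through positive resolutions of the identity: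
spectral resolutions of the arguments turn `Φ` of any powers of them into a finite sum
`∑ J, ν J ^ r • C J` with `C J ≥ 0` and `∑ J, C J = 1`. For such sums the Jensen inequalities for
`x⁻¹` (by completing squares) and for `x ^ t`, `0 ≤ t ≤ 1` (by the integral representation of
`x ^ t` in terms of resolvents) are elementary. Conjugation by a square root turns the
latter into `CMat.sum_rpow_smul_le_geomMean`, from which follow symmetry, monotonicity and
homogeneity of `X ♯_t A` as well as
`Φ(X₁ ♯_t A₁, …, Xₙ ♯_t Aₙ) ≤ Φ(X₁, …, Xₙ) ♯_t Φ(A₁, …, Aₙ)` (`CMat.map_geomMean_le`).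

Write `F X = ∑ i, ω i (X ♯_t A i)`. As `F` is monotone and `F (c X) = c ^ (1 - t) F X`, every
subsolution `Y ≤ F Y` lies below every solution of `X = F X` (`CMat.le_of_le_powerMeanMap`), and a
solution exists as a supersolution of least trace (`CMat.exists_isPowerMeanSolution`).
Expanding `Φ(X₁, …, Xₙ)` for `Xᵢ = P_t(ω⁽ⁱ⁾; 𝔸⁽ⁱ⁾)` by multilinearity shows that it is a subsolution
for the product weights and the tuple `Φ(𝔸⁽¹⁾, …, 𝔸⁽ⁿ⁾)`, which is the inequality for positive `t`.

For negative `t` put `s = -t` and let `Xᵢ` be the power mean of the inverses with exponent `s`.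
With the Kantorovich constant `K` for the interval `[m ^ n, M ^ n]`, the Kantorovich inequality
`Φ(A⁻¹) ≤ K Φ(A)⁻¹` makes `K⁻¹ Φ(X)` a subsolution for the inverted data `Φ(A)⁻¹`; taking inverses
and using `Φ(X)⁻¹ ≤ Φ(X⁻¹)` gives the claim.
-/

/-! ### Spectral resolutions -/

theorem CMat.posDef_of_le {d : ℕ} {A B : CMat d} (hA : A.PosDef) (h : A ≤ B) : B.PosDef := by
  have := hA.add_posSemidef (Matrix.le_iff.1 h)
  rwa [add_sub_cancel] at this

theorem CMat.posDef_smul {d : ℕ} {A : CMat d} (hA : A.PosDef) {c : ℝ} (hc : 0 < c) :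
    (c • A).PosDef :=
  Matrix.PosDef.smul hA hc

theorem CMat.inv_eq_rpow {d : ℕ} {A : CMat d} (hA : A.PosDef) : A⁻¹ = A ^ (-1 : ℝ) := by
  apply Matrix.inv_eq_right_inv
  have h := CFC.rpow_mul_rpow_neg (a := A) 1 hA.isStrictlyPositive
  rwa [CFC.rpow_one A hA.posSemidef.nonneg] at h

/-- A spectral resolution of a strictly positive matrix: a finite resolution of the identity
`P` by positive semidefinite matrices that simultaneously writes all real powers of `A`. The
`P j` are the orthogonal rank-one projections on an eigenbasis; of this, only the multiplication
rule for their linear combinations is recorded. -/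
theorem CMat.exists_spectral_resolution {d : ℕ} {A : CMat d} (hA : A.PosDef) :
    ∃ (μ : Fin d → ℝ) (P : Fin d → CMat d), (∀ j, 0 < μ j) ∧ (∀ j, 0 ≤ P j) ∧ ∑ j, P j = 1 ∧
      (∀ r : ℝ, A ^ r = ∑ j, μ j ^ r • P j) ∧
      (∀ f g : Fin d → ℝ, (∑ j, f j • P j) * ∑ j, g j • P j = ∑ j, (f j * g j) • P j) ∧
      (∀ c : ℝ, c • (1 : CMat d) ≤ A → ∀ j, c ≤ μ j) ∧
      (∀ c : ℝ, A ≤ c • (1 : CMat d) → ∀ j, μ j ≤ c) := by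
  set U : CMat d := (hA.1.eigenvectorUnitary : CMat d) with hU
  have hUU : star U * U = 1 := Unitary.coe_star_mul_self hA.1.eigenvectorUnitary
  have hUU' : U * star U = 1 := Unitary.coe_mul_star_self hA.1.eigenvectorUnitary
  have key : ∀ f : Fin d → ℝ, ∑ j, f j • (U * Matrix.single j j (1 : ℂ) * star U)
      = U * Matrix.diagonal (fun j => (f j : ℂ)) * star U := by
    intro f
    have hd : Matrix.diagonal (fun j => (f j : ℂ)) = ∑ j, f j • Matrix.single j j (1 : ℂ) := by
      ext a b
      simp only [Matrix.sum_apply, Matrix.smul_apply, Matrix.single_apply, Matrix.diagonal_apply]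
      by_cases hab : a = b
      · subst hab
        simp [Finset.sum_ite_eq']
      · rw [if_neg hab]
        refine (Finset.sum_eq_zero fun j _ => ?_).symm
        rw [if_neg (by rintro ⟨rfl, rfl⟩; exact hab rfl), smul_zero]
    rw [hd, Finset.mul_sum, Finset.sum_mul]
    simp only [mul_smul_comm, smul_mul_assoc]
  refine ⟨hA.1.eigenvalues, fun j => U * Matrix.single j j 1 * star U, hA.eigenvalues_pos,
    fun j => ?_, ?_, fun r => ?_, fun f g => ?_, fun c hc j => ?_, fun c hc j => ?_⟩
  · refine (Matrix.PosSemidef.mul_mul_conjTranspose_same ?_ U).nonneg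
    rw [← Matrix.diagonal_single, Matrix.posSemidef_diagonal_iff]
    intro i
    by_cases hij : i = j
    · subst hij; simp
    · simp [Pi.single_eq_of_ne hij]
  · have h := key fun _ => 1
    simpa [hUU'] using h
  · rw [key, CFC.rpow_eq_cfc_real hA.posSemidef.nonneg, hA.1.cfc_eq, Matrix.IsHermitian.cfc,
      Unitary.conjStarAlgAut_apply]
    rfl
  · rw [key, key, key]
    calc _ = U * Matrix.diagonal (fun j => (f j : ℂ)) * (star U * U)
          * Matrix.diagonal (fun j => (g j : ℂ)) * star U := by simp only [mul_assoc]
      _ = _ := by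
        rw [hUU, mul_one, mul_assoc U, Matrix.diagonal_mul_diagonal]
        simp
  · rw [← Algebra.algebraMap_eq_smul_one, algebraMap_le_iff_le_spectrum hA.1.isSelfAdjoint] at hc
    exact hc _ (hA.1.eigenvalues_mem_spectrum_real j)
  · rw [← Algebra.algebraMap_eq_smul_one, le_algebraMap_iff_spectrum_le hA.1.isSelfAdjoint] at hc
    exact hc _ (hA.1.eigenvalues_mem_spectrum_real j)

/-! ### Jensen inequalities for positive resolutions of the identity -/

/-- Jensen's inequality for the inverse, in the form needed for resolvents: `Z` plays the role of
`B⁻¹`, of which only `Z B Z = Z` is used. -/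
theorem CMat.le_sum_inv_smul {ι : Type*} [Fintype ι] {d : ℕ} {C : ι → CMat d} {μ : ι → ℝ}
    {B Z : CMat d} (hC : ∀ i, 0 ≤ C i) (hC1 : ∑ i, C i = 1) (hμ : ∀ i, 0 < μ i)
    (hB : ∑ i, μ i • C i ≤ B) (hZ : IsSelfAdjoint Z) (hZB : Z * B * Z = Z) :
    Z ≤ ∑ i, (μ i)⁻¹ • C i := by
  -- Complete the square: `(μ⁻¹ - Z) (μ C) (μ⁻¹ - Z) ≥ 0` for each term, then sum.
  have h1 : ∀ i, 0 ≤ (μ i)⁻¹ • C i - (C i * Z + Z * C i) + Z * (μ i • C i) * Z := by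
    intro i
    have h : 0 ≤ ((μ i)⁻¹ • (1 : CMat d) - Z) * (μ i • C i) * ((μ i)⁻¹ • (1 : CMat d) - Z) := by
      refine IsSelfAdjoint.conjugate_nonneg (smul_nonneg (hμ i).le (hC i)) ?_
      exact (IsSelfAdjoint.smul (by simp [IsSelfAdjoint]) (.one _)).sub hZ
    convert h using 1
    have hne := (hμ i).ne'
    simp only [sub_mul, mul_sub, smul_mul_assoc, mul_smul_comm, one_mul, mul_one, smul_smul,
      smul_sub]
    simp only [mul_inv_cancel₀ hne, inv_mul_cancel₀ hne, one_smul, mul_one]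
    abel
  have h2 := Finset.sum_nonneg fun i (_ : i ∈ Finset.univ) => h1 i
  simp only [Finset.sum_add_distrib, Finset.sum_sub_distrib, ← Finset.sum_mul, ← Finset.mul_sum,
    hC1, one_mul, mul_one] at h2
  have h3 := IsSelfAdjoint.conjugate_le_conjugate hB hZ
  rw [hZB] at h3
  have h4 := h2.trans (add_le_add_right h3 _)
  rw [← sub_nonneg]
  convert h4 using 1
  abel

/-- Jensen's inequality for the operator convex function `x ↦ x⁻¹`. -/
theorem CMat.inv_le_sum_inv_smul {ι : Type*} [Fintype ι] {d : ℕ} {C : ι → CMat d} {μ : ι → ℝ}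
    {B : CMat d} (hC : ∀ i, 0 ≤ C i) (hC1 : ∑ i, C i = 1) (hμ : ∀ i, 0 < μ i)
    (hB' : B.PosDef) (hB : ∑ i, μ i • C i ≤ B) : B⁻¹ ≤ ∑ i, (μ i)⁻¹ • C i := by
  refine le_sum_inv_smul hC hC1 hμ hB hB'.inv.1.isSelfAdjoint ?_
  rw [Matrix.nonsing_inv_mul _ ((Matrix.isUnit_iff_isUnit_det _).1 hB'.isUnit), one_mul]

theorem CMat.inv_le_inv {d : ℕ} {A B : CMat d} (hA : A.PosDef) (h : A ≤ B) : B⁻¹ ≤ A⁻¹ := by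
  obtain ⟨μ, P, hμ, hP, hP1, hpow, -, -, -⟩ := exists_spectral_resolution hA
  have h1 := hpow 1
  have h2 := hpow (-1)
  simp only [CFC.rpow_one A hA.posSemidef.nonneg, Real.rpow_one] at h1
  simp only [← inv_eq_rpow hA, Real.rpow_neg_one] at h2
  rw [h2]
  exact inv_le_sum_inv_smul hP hP1 hμ (posDef_of_le hA h) (h1 ▸ h)

open MeasureTheory in
open scoped Matrix.Norms.L2Operator in
theorem CMat.integral_sum_rpowIntegrand {ι : Type*} [Fintype ι] {d : ℕ} {t : ℝ} {m : Measure ℝ}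
    (hm : ∀ x ∈ Set.Ici (0 : ℝ), IntegrableOn (fun s => Real.rpowIntegrand₀₁ t s x) (Set.Ioi 0) m ∧
      x ^ t = ∫ s in Set.Ioi 0, Real.rpowIntegrand₀₁ t s x ∂m)
    (C : ι → CMat d) {μ : ι → ℝ} (hμ : ∀ i, 0 < μ i) :
    IntegrableOn (fun s => ∑ i, Real.rpowIntegrand₀₁ t s (μ i) • C i) (Set.Ioi 0) m ∧
      ∑ i, μ i ^ t • C i
        = ∫ s in Set.Ioi 0, ∑ i, Real.rpowIntegrand₀₁ t s (μ i) • C i ∂m := by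
  have hi : ∀ i, IntegrableOn (fun s => Real.rpowIntegrand₀₁ t s (μ i) • C i) (Set.Ioi 0) m :=
    fun i => (hm (μ i) (hμ i).le).1.smul_const _
  refine ⟨integrable_finsetSum _ fun i _ => hi i, ?_⟩
  rw [integral_finsetSum _ fun i _ => hi i]
  refine Finset.sum_congr rfl fun i _ => ?_
  rw [integral_smul_const, (hm (μ i) (hμ i).le).2]

open scoped Matrix.Norms.L2Operator in
/-- Jensen's inequality for the operator concave function `x ↦ x ^ t`. It reduces to the
one for resolvents through the integral representation of `x ^ t`. Allowing
`∑ i, μ i • C i ≤ B` in place of an equality includes operator monotonicity. -/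
theorem CMat.sum_rpow_smul_le_rpow {ι : Type*} [Fintype ι] {d : ℕ} {C : ι → CMat d} {μ : ι → ℝ}
    {B : CMat d} {t : ℝ} (ht0 : 0 ≤ t) (ht1 : t ≤ 1) (hC : ∀ i, 0 ≤ C i) (hC1 : ∑ i, C i = 1)
    (hμ : ∀ i, 0 < μ i) (hB' : B.PosDef) (hB : ∑ i, μ i • C i ≤ B) :
    ∑ i, μ i ^ t • C i ≤ B ^ t := by
  rcases ht0.eq_or_lt with rfl | ht0
  · simp only [Real.rpow_zero, one_smul, hC1]
    rw [CFC.rpow_zero B hB'.posSemidef.nonneg]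
  rcases ht1.eq_or_lt with rfl | ht1
  · simpa only [Real.rpow_one, CFC.rpow_one B hB'.posSemidef.nonneg]
  obtain ⟨ν, Q, hν, hQ, hQ1, hpow, hmul, -, -⟩ := exists_spectral_resolution hB'
  have hBQ := hpow 1
  simp only [CFC.rpow_one B hB'.posSemidef.nonneg, Real.rpow_one] at hBQ
  obtain ⟨m, hm⟩ := Real.exists_measure_rpow_eq_integral_rpowIntegrand₀₁ ⟨ht0, ht1⟩
  have hiμ := integral_sum_rpowIntegrand hm C hμ
  have hiν := integral_sum_rpowIntegrand hm Q hν
  rw [hpow t, hiμ.2, hiν.2]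
  refine MeasureTheory.setIntegral_mono_on hiμ.1 hiν.1 measurableSet_Ioi ?_
  intro s hs
  have hs : 0 < s := hs
  have h1 : ∑ i, (s + ν i)⁻¹ • Q i ≤ ∑ i, (s + μ i)⁻¹ • C i := by
    refine le_sum_inv_smul (B := ∑ i, (s + ν i) • Q i) hC hC1
      (fun i => add_pos hs (hμ i)) ?_ ?_ ?_
    · simp only [add_smul, Finset.sum_add_distrib, ← Finset.smul_sum, hC1, hQ1, ← hBQ]
      exact add_le_add_right hB _
    · exact .of_nonneg (Finset.sum_nonneg fun i _ =>
        smul_nonneg (inv_nonneg.2 (add_pos hs (hν i)).le) (hQ i))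
    · rw [hmul, hmul]
      refine Finset.sum_congr rfl fun i _ => ?_
      rw [inv_mul_cancel₀ (add_pos hs (hν i)).ne', one_mul]
  simp only [Real.rpowIntegrand₀₁, mul_sub, sub_smul, Finset.sum_sub_distrib, mul_smul,
    ← Finset.smul_sum, hC1, hQ1]
  exact sub_le_sub_left (smul_le_smul_of_nonneg_left h1 (Real.rpow_nonneg hs.le t)) _

/-! ### The weighted geometric mean -/

/-- The square root `S` of `X` and its inverse `T`, with the properties by which the geometric
mean is computed. -/
theorem CMat.exists_sqrt {d : ℕ} {X : CMat d} (hX : X.PosDef) :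
    ∃ S T : CMat d, IsSelfAdjoint S ∧ IsSelfAdjoint T ∧ S * T = 1 ∧ T * S = 1 ∧ S * S = X ∧
      (∀ A : CMat d, A.PosDef → (T * A * T).PosDef) ∧
      ∀ (t : ℝ) (A : CMat d), geomMean t X A = S * (T * A * T) ^ t * S := by
  have hTsa : IsSelfAdjoint (X ^ (-(1 / 2) : ℝ)) := .of_nonneg CFC.rpow_nonneg
  refine ⟨X ^ (1 / 2 : ℝ), X ^ (-(1 / 2) : ℝ), .of_nonneg CFC.rpow_nonneg, hTsa,
    CFC.rpow_mul_rpow_neg _ hX.isStrictlyPositive, CFC.rpow_neg_mul_rpow _ hX.isStrictlyPositive,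
    ?_, fun A hA => ?_, fun _ _ => rfl⟩
  · rw [← CFC.rpow_add hX.isUnit, add_halves, CFC.rpow_one X hX.posSemidef.nonneg]
  · have h := (Matrix.IsUnit.posDef_star_left_conjugate_iff (x := A)
      (hX.isUnit.cfcRpow (-(1 / 2)) hX.posSemidef.nonneg)).2 hA
    rwa [hTsa.star_eq] at h

/-- A simultaneous decomposition of `X` and `A` into proportional positive semidefinite parts,
obtained from a spectral resolution of `X^(-1/2) A X^(-1/2)` by conjugation with `X^(1/2)`. It
turns every geometric mean of `X` and `A` into a finite sum with scalar powers. -/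
theorem CMat.exists_geomMean_resolution {d : ℕ} {X A : CMat d} (hX : X.PosDef) (hA : A.PosDef) :
    ∃ (μ : Fin d → ℝ) (R : Fin d → CMat d), (∀ j, 0 < μ j) ∧ (∀ j, 0 ≤ R j) ∧ ∑ j, R j = X ∧
      ∑ j, μ j • R j = A ∧ ∀ t : ℝ, geomMean t X A = ∑ j, μ j ^ t • R j := by
  obtain ⟨S, T, hSsa, hTsa, hS, hS', hSS, hTA, hgm⟩ := exists_sqrt hX
  have hB := hTA A hA
  obtain ⟨μ, P, hμ, hP, hP1, hpow, -, -, -⟩ := exists_spectral_resolution hB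
  have hconj : ∀ f : Fin d → ℝ, S * (∑ j, f j • P j) * S = ∑ j, f j • (S * P j * S) := fun f => by
    simp only [Finset.mul_sum, Finset.sum_mul, mul_smul_comm, smul_mul_assoc]
  refine ⟨μ, fun j => S * P j * S, hμ, fun j => hSsa.conjugate_nonneg (hP j), ?_, ?_, fun t => ?_⟩
  · rw [← Finset.sum_mul, ← Finset.mul_sum, hP1, mul_one, hSS]
  · have h1 := hpow 1
    simp only [CFC.rpow_one _ hB.posSemidef.nonneg, Real.rpow_one] at h1
    rw [← hconj, ← h1]
    calc S * (T * A * T) * S = (S * T) * A * (T * S) := by simp only [mul_assoc]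
      _ = A := by rw [hS, hS', one_mul, mul_one]
  · rw [hgm, hpow, hconj]

/-- Jensen's inequality for the geometric mean: any simultaneous decomposition of `X` and of a
lower bound of `A` into proportional parts bounds the geometric mean from below. Symmetry,
monotonicity, homogeneity and the behaviour under positive multilinear maps all follow by
inserting suitable decompositions. -/
theorem CMat.sum_rpow_smul_le_geomMean {ι : Type*} [Fintype ι] {d : ℕ} {R : ι → CMat d}
    {μ : ι → ℝ} {X A : CMat d} {t : ℝ} (ht0 : 0 ≤ t) (ht1 : t ≤ 1) (hX : X.PosDef) (hA : A.PosDef)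
    (hR : ∀ i, 0 ≤ R i) (hμ : ∀ i, 0 < μ i) (hRX : ∑ i, R i = X) (hRA : ∑ i, μ i • R i ≤ A) :
    ∑ i, μ i ^ t • R i ≤ geomMean t X A := by
  obtain ⟨S, T, hSsa, hTsa, hS, hS', hSS, hTA, hgm⟩ := exists_sqrt hX
  have hB := hTA A hA
  rw [hgm]
  have hconj : ∀ f : ι → ℝ, T * (∑ j, f j • R j) * T = ∑ j, f j • (T * R j * T) := fun f => by
    simp only [Finset.mul_sum, Finset.sum_mul, mul_smul_comm, smul_mul_assoc]
  have key := sum_rpow_smul_le_rpow (C := fun i => T * R i * T) ht0 ht1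
    (fun i => hTsa.conjugate_nonneg (hR i)) ?_ hμ hB ?_
  · have h := hSsa.conjugate_le_conjugate key
    rw [← hconj] at h
    refine le_of_eq_of_le ?_ h
    calc ∑ i, μ i ^ t • R i = (S * T) * (∑ i, μ i ^ t • R i) * (T * S) := by
          rw [hS, hS', one_mul, mul_one]
      _ = _ := by simp only [mul_assoc]
  · rw [← Finset.sum_mul, ← Finset.mul_sum, hRX, ← hSS]
    calc T * (S * S) * T = (T * S) * (S * T) := by simp only [mul_assoc]
      _ = 1 := by rw [hS, hS', one_mul]
  · rw [← hconj]
    exact hTsa.conjugate_le_conjugate hRA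

theorem CMat.geomMean_self {d : ℕ} {X : CMat d} (hX : X.PosDef) (t : ℝ) : geomMean t X X = X := by
  obtain ⟨S, T, -, -, hS, hS', hSS, -, hgm⟩ := exists_sqrt hX
  have h1 : T * X * T = 1 := by
    calc T * X * T = (T * S) * (S * T) := by rw [← hSS]; simp only [mul_assoc]
      _ = 1 := by rw [hS, hS', one_mul]
  rw [hgm, h1, CFC.one_rpow, mul_one, hSS]

theorem CMat.geomMean_le_symm {d : ℕ} {X A : CMat d} (hX : X.PosDef) (hA : A.PosDef) {t : ℝ}
    (ht0 : 0 ≤ t) (ht1 : t ≤ 1) : geomMean t X A ≤ geomMean (1 - t) A X := by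
  obtain ⟨μ, R, hμ, hR, hRX, hRA, hgm⟩ := exists_geomMean_resolution hX hA
  have h := sum_rpow_smul_le_geomMean (R := fun i => μ i • R i) (μ := fun i => (μ i)⁻¹)
    (sub_nonneg.2 ht1) (sub_le_self 1 ht0) hA hX (fun i => smul_nonneg (hμ i).le (hR i))
    (fun i => inv_pos.2 (hμ i)) hRA ?_
  · refine le_of_eq_of_le ?_ h
    rw [hgm]
    refine Finset.sum_congr rfl fun i _ => ?_
    rw [smul_smul, Real.inv_rpow (hμ i).le, ← Real.rpow_neg (hμ i).le, ← Real.rpow_add_one (hμ i).ne']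
    ring_nf
  · refine le_of_eq ?_
    rw [← hRX]
    refine Finset.sum_congr rfl fun i _ => ?_
    rw [smul_smul, inv_mul_cancel₀ (hμ i).ne', one_smul]

theorem CMat.geomMean_symm {d : ℕ} {X A : CMat d} (hX : X.PosDef) (hA : A.PosDef) {t : ℝ}
    (ht0 : 0 ≤ t) (ht1 : t ≤ 1) : geomMean t X A = geomMean (1 - t) A X := by
  refine le_antisymm (geomMean_le_symm hX hA ht0 ht1) ?_
  simpa using geomMean_le_symm hA hX (sub_nonneg.2 ht1) (sub_le_self 1 ht0)

theorem CMat.geomMean_mono_right {d : ℕ} {X A A' : CMat d} (hX : X.PosDef) (hA : A.PosDef)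
    (h : A ≤ A') {t : ℝ} (ht0 : 0 ≤ t) (ht1 : t ≤ 1) : geomMean t X A ≤ geomMean t X A' := by
  obtain ⟨μ, R, hμ, hR, hRX, hRA, hgm⟩ := exists_geomMean_resolution hX hA
  rw [hgm]
  exact sum_rpow_smul_le_geomMean ht0 ht1 hX (posDef_of_le hA h) hR hμ hRX (hRA ▸ h)

theorem CMat.geomMean_mono_left {d : ℕ} {X X' A : CMat d} (hX : X.PosDef) (hA : A.PosDef)
    (h : X ≤ X') {t : ℝ} (ht0 : 0 ≤ t) (ht1 : t ≤ 1) : geomMean t X A ≤ geomMean t X' A := by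
  rw [geomMean_symm hX hA ht0 ht1, geomMean_symm (posDef_of_le hX h) hA ht0 ht1]
  exact geomMean_mono_right hA hX h (sub_nonneg.2 ht1) (sub_le_self 1 ht0)

theorem CMat.smul_geomMean_le {d : ℕ} {X A : CMat d} (hX : X.PosDef) (hA : A.PosDef) {t : ℝ}
    (ht0 : 0 ≤ t) (ht1 : t ≤ 1) {a b : ℝ} (ha : 0 < a) (hb : 0 < b) :
    (a ^ (1 - t) * b ^ t) • geomMean t X A ≤ geomMean t (a • X) (b • A) := by
  obtain ⟨μ, R, hμ, hR, hRX, hRA, hgm⟩ := exists_geomMean_resolution hX hA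
  have h := sum_rpow_smul_le_geomMean (R := fun i => a • R i) (μ := fun i => b / a * μ i)
    ht0 ht1 (posDef_smul hX ha) (posDef_smul hA hb) (fun i => smul_nonneg ha.le (hR i))
    (fun i => mul_pos (div_pos hb ha) (hμ i)) (by rw [← Finset.smul_sum, hRX]) ?_
  · refine le_of_eq_of_le ?_ h
    rw [hgm, Finset.smul_sum]
    refine Finset.sum_congr rfl fun i _ => ?_
    rw [smul_smul, smul_smul, Real.mul_rpow (div_pos hb ha).le (hμ i).le,
      Real.div_rpow hb.le ha.le, Real.rpow_sub ha, Real.rpow_one]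
    congr 1
    ring
  · refine le_of_eq ?_
    rw [← hRA, Finset.smul_sum]
    refine Finset.sum_congr rfl fun i _ => ?_
    rw [smul_smul, smul_smul]
    congr 1
    field_simp

theorem CMat.geomMean_smul_left {d : ℕ} {X A : CMat d} (hX : X.PosDef) (hA : A.PosDef) {t : ℝ}
    (ht0 : 0 ≤ t) (ht1 : t ≤ 1) {a : ℝ} (ha : 0 < a) :
    geomMean t (a • X) A = a ^ (1 - t) • geomMean t X A := by
  have key : ∀ {a : ℝ} {X : CMat d}, 0 < a → X.PosDef →
      a ^ (1 - t) • geomMean t X A ≤ geomMean t (a • X) A := fun {a X} ha hX => by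
    simpa using smul_geomMean_le hX hA ht0 ht1 ha one_pos
  refine le_antisymm ?_ (key ha hX)
  have h := smul_le_smul_of_nonneg_left (key (inv_pos.2 ha) (posDef_smul hX ha))
    (Real.rpow_nonneg ha.le (1 - t))
  rwa [smul_smul, ← Real.mul_rpow ha.le (inv_pos.2 ha).le, mul_inv_cancel₀ ha.ne', Real.one_rpow,
    one_smul, smul_smul, inv_mul_cancel₀ ha.ne', one_smul] at h

/-! ### The matrix power mean: comparison and existence -/

theorem CMat.exists_smul_one_le_le {d : ℕ} {ι : Type*} [Finite ι] {A : ι → CMat d}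
    (hA : ∀ i, (A i).PosDef) :
    ∃ a b : ℝ, 0 < a ∧ 0 < b ∧ ∀ i, a • (1 : CMat d) ≤ A i ∧ A i ≤ b • (1 : CMat d) := by
  have key : ∀ i, (∀ᶠ a in nhdsWithin (0 : ℝ) (Set.Ioi 0), a • (1 : CMat d) ≤ A i) ∧
      ∀ᶠ b in Filter.atTop, A i ≤ (b : ℝ) • (1 : CMat d) := by
    intro i
    obtain ⟨μ, P, hμ, hP, hP1, hpow, -, -, -⟩ := exists_spectral_resolution (hA i)
    have h1 := hpow 1
    simp only [CFC.rpow_one _ (hA i).posSemidef.nonneg, Real.rpow_one] at h1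
    rw [h1, ← hP1]
    constructor
    · have h : ∀ᶠ a in nhdsWithin (0 : ℝ) (Set.Ioi 0), ∀ j, a < μ j :=
        Filter.eventually_all.2 fun j => nhdsWithin_le_nhds (eventually_lt_nhds (hμ j))
      filter_upwards [h] with a ha
      rw [Finset.smul_sum]
      exact Finset.sum_le_sum fun j _ => smul_le_smul_of_nonneg_right (ha j).le (hP j)
    · have h : ∀ᶠ b in Filter.atTop, ∀ j, μ j ≤ b :=
        Filter.eventually_all.2 fun j => Filter.eventually_ge_atTop (μ j)
      filter_upwards [h] with b hb
      rw [Finset.smul_sum]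
      exact Finset.sum_le_sum fun j _ => smul_le_smul_of_nonneg_right (hb j) (hP j)
  obtain ⟨a, ha, ha0⟩ := ((Filter.eventually_all.2 fun i => (key i).1).and
    self_mem_nhdsWithin).exists
  obtain ⟨b, hb, hb0⟩ := ((Filter.eventually_all.2 fun i => (key i).2).and
    (Filter.eventually_gt_atTop 0)).exists
  exact ⟨a, b, ha0, hb0, fun i => ⟨ha i, hb i⟩⟩

/-- The map `X ↦ ∑ i, ω i (X ♯_t A i)` whose fixed points are the power means. -/
noncomputable def powerMeanMap {d : ℕ} {ι : Type*} [Fintype ι] (t : ℝ) (ω : ι → ℝ)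
    (A : ι → CMat d) (X : CMat d) : CMat d :=
  ∑ i, ω i • geomMean t X (A i)

namespace CMat

variable {d : ℕ} {ι : Type*} [Fintype ι] {t : ℝ} {ω : ι → ℝ} {A : ι → CMat d}

theorem powerMeanMap_mono (ht0 : 0 ≤ t) (ht1 : t ≤ 1) (hω : IsWeight ω) (hA : ∀ i, (A i).PosDef)
    {X Y : CMat d} (hX : X.PosDef) (h : X ≤ Y) : powerMeanMap t ω A X ≤ powerMeanMap t ω A Y :=
  Finset.sum_le_sum fun i _ =>
    smul_le_smul_of_nonneg_left (geomMean_mono_left hX (hA i) h ht0 ht1) (hω.1 i)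

theorem powerMeanMap_smul (ht0 : 0 ≤ t) (ht1 : t ≤ 1) (hA : ∀ i, (A i).PosDef) {X : CMat d}
    (hX : X.PosDef) {c : ℝ} (hc : 0 < c) :
    powerMeanMap t ω A (c • X) = c ^ (1 - t) • powerMeanMap t ω A X := by
  simp only [powerMeanMap, Finset.smul_sum]
  refine Finset.sum_congr rfl fun i _ => ?_
  rw [geomMean_smul_left hX (hA i) ht0 ht1 hc, smul_comm]

theorem smul_one_le_powerMeanMap (ht0 : 0 ≤ t) (ht1 : t ≤ 1) (hω : IsWeight ω) {a : ℝ} (ha : 0 < a)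
    (hA : ∀ i, a • (1 : CMat d) ≤ A i) :
    a • (1 : CMat d) ≤ powerMeanMap t ω A (a • (1 : CMat d)) := by
  have h1 : (a • (1 : CMat d)).PosDef := posDef_smul .one ha
  calc a • (1 : CMat d) = ∑ i, ω i • (a • (1 : CMat d)) := by
        rw [← Finset.sum_smul, hω.2, one_smul]
    _ ≤ _ := Finset.sum_le_sum fun i _ => smul_le_smul_of_nonneg_left
        (le_of_eq_of_le (geomMean_self h1 t).symm (geomMean_mono_right h1 h1 (hA i) ht0 ht1))
        (hω.1 i)

theorem powerMeanMap_le_smul_one (ht0 : 0 ≤ t) (ht1 : t ≤ 1) (hω : IsWeight ω) {b : ℝ} (hb : 0 < b)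
    (hA : ∀ i, (A i).PosDef) (hAb : ∀ i, A i ≤ b • (1 : CMat d)) :
    powerMeanMap t ω A (b • (1 : CMat d)) ≤ b • (1 : CMat d) := by
  have h1 : (b • (1 : CMat d)).PosDef := posDef_smul .one hb
  calc powerMeanMap t ω A (b • (1 : CMat d)) ≤ ∑ i, ω i • (b • (1 : CMat d)) :=
        Finset.sum_le_sum fun i _ => smul_le_smul_of_nonneg_left
          ((geomMean_mono_right h1 (hA i) (hAb i) ht0 ht1).trans_eq (geomMean_self h1 t)) (hω.1 i)
    _ = _ := by rw [← Finset.sum_smul, hω.2, one_smul]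

open scoped Matrix.Norms.L2Operator in
/-- A subsolution of the power mean equation lies below every solution: from `Y ≤ c X` with
`c ≥ 1` the equation gives `Y ≤ c ^ (1 - t) X`, and iterating drives the factor to `1`. -/
theorem le_of_le_powerMeanMap (ht0 : 0 < t) (ht1 : t ≤ 1) (hω : IsWeight ω)
    (hA : ∀ i, (A i).PosDef) {X Y : CMat d} (hX : IsPowerMeanSolution t ω A X) (hY : Y.PosDef)
    (h : Y ≤ powerMeanMap t ω A Y) : Y ≤ X := by
  obtain ⟨hXpos, hXeq⟩ := hX
  change X = powerMeanMap t ω A X at hXeq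
  have step : ∀ c : ℝ, 0 < c → Y ≤ c • X → Y ≤ c ^ (1 - t) • X := fun c hc hYc => by
    calc Y ≤ powerMeanMap t ω A Y := h
      _ ≤ powerMeanMap t ω A (c • X) := powerMeanMap_mono ht0.le ht1 hω hA hY hYc
      _ = c ^ (1 - t) • X := by rw [powerMeanMap_smul ht0.le ht1 hA hXpos hc, ← hXeq]
  obtain ⟨a, _, ha, _, hab⟩ := exists_smul_one_le_le (A := fun _ : Unit => X) fun _ => hXpos
  obtain ⟨_, b, _, hb, hab'⟩ := exists_smul_one_le_le (A := fun _ : Unit => Y) fun _ => hY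
  have hc : 0 < b / a := div_pos hb ha
  have h0 : Y ≤ (b / a) • X := by
    refine (hab' ()).2.trans ?_
    have := smul_le_smul_of_nonneg_left (hab ()).1 hc.le
    rwa [smul_smul, div_mul_cancel₀ _ ha.ne'] at this
  have hk : ∀ k : ℕ, Y ≤ ((b / a) ^ ((1 - t) ^ k : ℝ)) • X := by
    intro k
    induction k with
    | zero => simpa using h0
    | succ k ih =>
      have := step _ (Real.rpow_pos_of_pos hc _) ih
      rwa [← Real.rpow_mul hc.le, ← pow_succ] at this
  have hlim : Filter.Tendsto (fun k : ℕ => ((b / a) ^ ((1 - t) ^ k : ℝ)) • X) Filter.atTop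
      (nhds ((1 : ℝ) • X)) := by
    refine Filter.Tendsto.smul_const ?_ X
    have h1 := tendsto_pow_atTop_nhds_zero_of_lt_one (sub_nonneg.2 ht1) (sub_lt_self 1 ht0)
    simpa using Filter.Tendsto.rpow (tendsto_const_nhds (x := b / a)) h1 (Or.inl hc.ne')
  simpa using ge_of_tendsto' hlim hk

open scoped Matrix.Norms.L2Operator in
/-- The supersolutions of the power mean equation in an order interval are closed. Nearby matrices
are comparable up to a factor close to `1`, so that monotonicity and homogeneity of the map
replace its continuity. -/
theorem isClosed_powerMeanMap_le (ht0 : 0 ≤ t) (ht1 : t ≤ 1) (hω : IsWeight ω)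
    (hA : ∀ i, (A i).PosDef) {a : ℝ} (ha : 0 < a) (b : ℝ) :
    IsClosed {X : CMat d | a • (1 : CMat d) ≤ X ∧ X ≤ b • (1 : CMat d) ∧
      powerMeanMap t ω A X ≤ X} := by
  refine isClosed_of_closure_subset fun X hXcl => ?_
  have hXI : X ∈ Set.Icc (a • (1 : CMat d)) (b • (1 : CMat d)) :=
    closure_minimal (fun Y hY => Set.mem_Icc.2 ⟨hY.1, hY.2.1⟩) isClosed_Icc hXcl
  refine ⟨hXI.1, hXI.2, ?_⟩
  have hX : X.PosDef := posDef_of_le (posDef_smul .one ha) hXI.1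
  have key : ∀ δ ∈ Set.Ioo (0 : ℝ) 1,
      (1 - δ) ^ (1 - t) • powerMeanMap t ω A X ≤ (1 + δ) • X := by
    rintro δ ⟨hδ0, hδ1⟩
    obtain ⟨Y, ⟨hY1, -, hY3⟩, hXY⟩ := Metric.mem_closure_iff.1 hXcl (δ * a) (mul_pos hδ0 ha)
    have hY : Y.PosDef := posDef_of_le (posDef_smul .one ha) hY1
    have hclose : ∀ {H : CMat d}, IsSelfAdjoint H → ‖H‖ ≤ δ * a → H ≤ δ • X := fun {H} hH hn => by
      calc H ≤ algebraMap ℝ (CMat d) ‖H‖ := hH.le_algebraMap_norm_self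
        _ = ‖H‖ • (1 : CMat d) := Algebra.algebraMap_eq_smul_one _
        _ ≤ (δ * a) • (1 : CMat d) :=
          smul_le_smul_of_nonneg_right hn Matrix.PosSemidef.one.nonneg
        _ = δ • (a • (1 : CMat d)) := mul_smul _ _ _
        _ ≤ δ • X := smul_le_smul_of_nonneg_left hXI.1 hδ0.le
    rw [dist_eq_norm] at hXY
    have h1 := hclose (hX.1.isSelfAdjoint.sub hY.1.isSelfAdjoint) hXY.le
    have h2 := hclose (hY.1.isSelfAdjoint.sub hX.1.isSelfAdjoint) (norm_sub_rev X Y ▸ hXY.le)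
    have h1' : (1 - δ) • X ≤ Y := by
      rw [sub_smul, one_smul]
      exact sub_le_comm.1 h1
    have h2' : Y ≤ (1 + δ) • X := by
      rw [add_smul, one_smul]
      exact sub_le_iff_le_add'.1 h2
    calc (1 - δ) ^ (1 - t) • powerMeanMap t ω A X = powerMeanMap t ω A ((1 - δ) • X) :=
          (powerMeanMap_smul ht0 ht1 hA hX (sub_pos.2 hδ1)).symm
      _ ≤ powerMeanMap t ω A Y :=
          powerMeanMap_mono ht0 ht1 hω hA (posDef_smul hX (sub_pos.2 hδ1)) h1'
      _ ≤ Y := hY3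
      _ ≤ (1 + δ) • X := h2'
  have hL : Filter.Tendsto (fun δ : ℝ => (1 - δ) ^ (1 - t) • powerMeanMap t ω A X)
      (nhdsWithin 0 (Set.Ioi 0)) (nhds ((1 : ℝ) • powerMeanMap t ω A X)) := by
    refine Filter.Tendsto.smul_const (Filter.Tendsto.mono_left ?_ nhdsWithin_le_nhds) _
    have hcont : ContinuousAt (fun δ : ℝ => (1 - δ) ^ (1 - t)) 0 :=
      (continuousAt_const.sub continuousAt_id).rpow_const (Or.inl (by simp))
    simpa [ContinuousAt] using hcont
  have hR : Filter.Tendsto (fun δ : ℝ => (1 + δ) • X)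
      (nhdsWithin 0 (Set.Ioi 0)) (nhds ((1 : ℝ) • X)) := by
    refine Filter.Tendsto.smul_const (Filter.Tendsto.mono_left ?_ nhdsWithin_le_nhds) _
    have hcont : ContinuousAt (fun δ : ℝ => 1 + δ) 0 := continuousAt_const.add continuousAt_id
    simpa [ContinuousAt] using hcont
  have := le_of_tendsto_of_tendsto hL hR
    (Filter.mem_of_superset (Ioo_mem_nhdsGT one_pos) key)
  simpa using this

open scoped Matrix.Norms.L2Operator in
/-- A solution of the power mean equation exists: among the supersolutions in an order interval
that the map preserves, one of least trace is a fixed point. -/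
theorem exists_isPowerMeanSolution (ht0 : 0 ≤ t) (ht1 : t ≤ 1) (hω : IsWeight ω)
    (hA : ∀ i, (A i).PosDef) : ∃ X, IsPowerMeanSolution t ω A X := by
  obtain ⟨a, b, ha, hb, hab⟩ := exists_smul_one_le_le hA
  have hne : Nonempty ι := by
    by_contra hι
    rw [not_nonempty_iff] at hι
    simpa using hω.2
  have hlow := smul_one_le_powerMeanMap ht0 ht1 hω ha fun i => (hab i).1
  have hpos : ∀ {X : CMat d}, a • (1 : CMat d) ≤ X → X.PosDef :=
    fun h => posDef_of_le (posDef_smul .one ha) h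
  set K : Set (CMat d) := {X : CMat d | a • (1 : CMat d) ≤ X ∧ X ≤ b • (1 : CMat d) ∧
      powerMeanMap t ω A X ≤ X} with hK
  have hKc : IsCompact K := by
    refine Metric.isCompact_of_isClosed_isBounded
      (isClosed_powerMeanMap_le ht0 ht1 hω hA ha b) ?_
    refine (Metric.isBounded_closedBall (x := (0 : CMat d))
      (r := ‖b • (1 : CMat d)‖)).subset fun X hX => ?_
    rw [mem_closedBall_zero_iff]
    exact CStarAlgebra.norm_le_norm_of_nonneg_of_le (hpos hX.1).posSemidef.nonneg hX.2.1
  have hKne : K.Nonempty := ⟨b • (1 : CMat d), (hab hne.some).1.trans (hab hne.some).2, le_rfl,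
    powerMeanMap_le_smul_one ht0 ht1 hω hb hA fun i => (hab i).2⟩
  have hcont : Continuous fun X : CMat d => X.trace.re :=
    Complex.continuous_re.comp (Continuous.matrix_trace continuous_id)
  obtain ⟨X, hXK, hmin⟩ := hKc.exists_isMinOn hKne hcont.continuousOn
  have hX := hpos hXK.1
  have hFlow : a • (1 : CMat d) ≤ powerMeanMap t ω A X :=
    hlow.trans (powerMeanMap_mono ht0 ht1 hω hA (hpos le_rfl) hXK.1)
  have hFK : powerMeanMap t ω A X ∈ K := ⟨hFlow, hXK.2.2.trans hXK.2.1,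
    powerMeanMap_mono ht0 ht1 hω hA (hpos hFlow) hXK.2.2⟩
  have htr : X.trace.re ≤ (powerMeanMap t ω A X).trace.re := hmin hFK
  have hpsd := Matrix.le_iff.1 hXK.2.2
  have h0 : (X - powerMeanMap t ω A X).trace = 0 := by
    have hnn := Complex.nonneg_iff.1 hpsd.trace_nonneg
    refine Complex.ext ?_ hnn.2.symm
    refine le_antisymm ?_ hnn.1
    rw [Matrix.trace_sub, Complex.sub_re, Complex.zero_re]
    exact sub_nonpos.2 htr
  exact ⟨X, hX, sub_eq_zero.1 (hpsd.trace_eq_zero_iff.1 h0)⟩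

theorem powerMeanPos_spec (ht0 : 0 ≤ t) (ht1 : t ≤ 1) (hω : IsWeight ω)
    (hA : ∀ i, (A i).PosDef) : IsPowerMeanSolution t ω A (powerMeanPos t ω A) := by
  have h := exists_isPowerMeanSolution ht0 ht1 hω hA
  rw [powerMeanPos, dif_pos h]
  exact h.choose_spec

end CMat

/-! ### Positive unital multilinear maps -/

namespace CMat

variable {n k q p : ℕ} {Φ : MultilinearMap ℂ (fun _ : Fin n => CMat q) (CMat p)}

theorem map_sum_smul (Φ : MultilinearMap ℂ (fun _ : Fin n => CMat q) (CMat p)) {κ : Type*}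
    [Fintype κ] (f : Fin n → κ → ℝ) (P : Fin n → κ → CMat q) :
    Φ (fun i => ∑ j, f i j • P i j)
      = ∑ J : Fin n → κ, (∏ i, f i (J i)) • Φ (fun i => P i (J i)) := by
  rw [MultilinearMap.map_sum]
  exact Finset.sum_congr rfl fun J _ => (Φ.restrictScalars ℝ).map_smul_univ _ _

theorem map_nonneg (hpos : IsPositiveMultilinear Φ) {P : Fin n → CMat q} (hP : ∀ i, 0 ≤ P i) :
    0 ≤ Φ P :=
  (hpos P fun i => Matrix.nonneg_iff_posSemidef.1 (hP i)).nonneg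

/-- Spectral resolutions of the arguments expand `Φ A` over a positive resolution of the identity
`C`, indexed by tuples of eigenvectors, whose coefficients are products of eigenvalues. -/
theorem exists_map_resolution (hpos : IsPositiveMultilinear Φ) (hunital : IsUnitalMultilinear Φ)
    {A : Fin n → CMat q} (hA : ∀ i, (A i).PosDef) :
    ∃ (ν : (Fin n → Fin q) → ℝ) (C : (Fin n → Fin q) → CMat p), (∀ J, 0 < ν J) ∧
      (∀ J, 0 ≤ C J) ∧ ∑ J, C J = 1 ∧ Φ A = ∑ J, ν J • C J ∧
      Φ (fun i => (A i)⁻¹) = ∑ J, (ν J)⁻¹ • C J ∧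
      (∀ c : ℝ, 0 ≤ c → (∀ i, c • (1 : CMat q) ≤ A i) → ∀ J, c ^ n ≤ ν J) ∧
      (∀ c : ℝ, (∀ i, A i ≤ c • (1 : CMat q)) → ∀ J, ν J ≤ c ^ n) := by
  choose μ P hμ hP hP1 hpow _ hlow hup using fun i => exists_spectral_resolution (hA i)
  refine ⟨fun J => ∏ i, μ i (J i), fun J => Φ fun i => P i (J i),
    fun J => Finset.prod_pos fun i _ => hμ i _, fun J => map_nonneg hpos fun i => hP i _,
    ?_, ?_, ?_, fun c hc h J => ?_, fun c h J => ?_⟩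
  · rw [← MultilinearMap.map_sum]
    simp only [hP1]
    exact hunital
  · rw [← map_sum_smul]
    congr 1
    funext i
    rw [← CFC.rpow_one (A i) (hA i).posSemidef.nonneg, hpow]
    simp only [Real.rpow_one]
  · simp only [← Finset.prod_inv_distrib]
    rw [← map_sum_smul Φ (fun i j => (μ i j)⁻¹) P]
    congr 1
    funext i
    rw [inv_eq_rpow (hA i), hpow]
    simp only [Real.rpow_neg_one]
  · calc c ^ n = ∏ _i : Fin n, c := by simp
      _ ≤ _ := Finset.prod_le_prod (fun _ _ => hc) fun i _ => hlow i c (h i) _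
  · calc _ ≤ ∏ _i : Fin n, c :=
          Finset.prod_le_prod (fun i _ => (hμ i _).le) fun i _ => hup i c (h i) _
      _ = c ^ n := by simp

theorem map_posDef (hpos : IsPositiveMultilinear Φ) (hunital : IsUnitalMultilinear Φ)
    {A : Fin n → CMat q} (hA : ∀ i, (A i).PosDef) : (Φ A).PosDef := by
  obtain ⟨ν, C, -, hC, hC1, hΦ, -, hlow, -⟩ := exists_map_resolution hpos hunital hA
  obtain ⟨a, _, ha, _, hab⟩ := exists_smul_one_le_le hA
  refine posDef_of_le (posDef_smul Matrix.PosDef.one (pow_pos ha n)) ?_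
  rw [hΦ, ← hC1, Finset.smul_sum]
  exact Finset.sum_le_sum fun J _ =>
    smul_le_smul_of_nonneg_right (hlow a ha.le (fun i => (hab i).1) J) (hC J)

theorem inv_map_le_map_inv (hpos : IsPositiveMultilinear Φ) (hunital : IsUnitalMultilinear Φ)
    {A : Fin n → CMat q} (hA : ∀ i, (A i).PosDef) : (Φ A)⁻¹ ≤ Φ fun i => (A i)⁻¹ := by
  obtain ⟨ν, C, hν, hC, hC1, hΦ, hΦ', -, -⟩ := exists_map_resolution hpos hunital hA
  rw [hΦ']
  exact inv_le_sum_inv_smul hC hC1 hν (map_posDef hpos hunital hA) hΦ.ge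

/-- The Kantorovich inequality, reverse to Jensen's inequality for the inverse: `x⁻¹` lies below
the chord of its graph over `[l, u]`, and the chord is compared with `B⁻¹` by completing a
square. -/
theorem sum_inv_smul_le {ι : Type*} [Fintype ι] {d : ℕ} {C : ι → CMat d} {μ : ι → ℝ} {B : CMat d}
    {l u : ℝ} (hl : 0 < l) (hC : ∀ i, 0 ≤ C i) (hC1 : ∑ i, C i = 1) (hlμ : ∀ i, l ≤ μ i)
    (hμu : ∀ i, μ i ≤ u) (hu : 0 < u) (hB' : B.PosDef) (hB : ∑ i, μ i • C i = B) :
    ∑ i, (μ i)⁻¹ • C i ≤ ((u + l) ^ 2 / (4 * u * l)) • B⁻¹ := by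
  have h1 : ∑ i, (μ i)⁻¹ • C i ≤ (u * l)⁻¹ • ((u + l) • (1 : CMat d) - B) := by
    rw [← hB, ← hC1, Finset.smul_sum, ← Finset.sum_sub_distrib, Finset.smul_sum]
    refine Finset.sum_le_sum fun i _ => ?_
    rw [← sub_smul, smul_smul]
    refine smul_le_smul_of_nonneg_right ?_ (hC i)
    have hμ : 0 < μ i := hl.trans_le (hlμ i)
    rw [inv_mul_eq_div, le_div_iff₀ (mul_pos hu hl), inv_mul_le_iff₀ hμ]
    nlinarith [mul_nonneg (sub_nonneg.2 (hlμ i)) (sub_nonneg.2 (hμu i))]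
  refine h1.trans ?_
  have hdet := (Matrix.isUnit_iff_isUnit_det _).1 hB'.isUnit
  have hsq : 0 ≤ (((u + l) / 2) • (1 : CMat d) - B) * B⁻¹ * (((u + l) / 2) • (1 : CMat d) - B) := by
    refine IsSelfAdjoint.conjugate_nonneg hB'.inv.posSemidef.nonneg ?_
    exact (IsSelfAdjoint.smul (by simp [IsSelfAdjoint]) (.one _)).sub hB'.1.isSelfAdjoint
  have hexp : (((u + l) / 2) • (1 : CMat d) - B) * B⁻¹ * (((u + l) / 2) • (1 : CMat d) - B)
      = ((u + l) ^ 2 / 4) • B⁻¹ - ((u + l) • (1 : CMat d) - B) := by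
    simp only [sub_mul, mul_sub, smul_mul_assoc, mul_smul_comm, one_mul, mul_one,
      Matrix.mul_nonsing_inv _ hdet, Matrix.nonsing_inv_mul _ hdet, smul_sub, smul_smul]
    module
  rw [hexp, sub_nonneg] at hsq
  have h2 := smul_le_smul_of_nonneg_left hsq (inv_nonneg.2 (mul_pos hu hl).le)
  refine h2.trans_eq ?_
  rw [smul_smul]
  congr 1
  field_simp

theorem map_inv_le_smul_inv_map (hpos : IsPositiveMultilinear Φ) (hunital : IsUnitalMultilinear Φ)
    {A : Fin n → CMat q} (hA : ∀ i, (A i).PosDef) {m M : ℝ} (hm : 0 < m) (hM : 0 < M)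
    (hmA : ∀ i, m • (1 : CMat q) ≤ A i) (hAM : ∀ i, A i ≤ M • (1 : CMat q)) :
    Φ (fun i => (A i)⁻¹) ≤ ((M ^ n + m ^ n) ^ 2 / (4 * M ^ n * m ^ n)) • (Φ A)⁻¹ := by
  obtain ⟨ν, C, -, hC, hC1, hΦ, hΦ', hlow, hup⟩ := exists_map_resolution hpos hunital hA
  rw [hΦ']
  exact sum_inv_smul_le (pow_pos hm n) hC hC1 (hlow m hm.le hmA) (hup M hAM) (pow_pos hM n)
    (map_posDef hpos hunital hA) hΦ.symm

/-- Positive unital multilinear maps are subhomomorphic for the geometric mean: the images of the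
simultaneous decompositions of `X i` and `A i` decompose `Φ X` and `Φ A` simultaneously. -/
theorem map_geomMean_le (hpos : IsPositiveMultilinear Φ) (hunital : IsUnitalMultilinear Φ)
    {X A : Fin n → CMat q} (hX : ∀ i, (X i).PosDef) (hA : ∀ i, (A i).PosDef) {t : ℝ}
    (ht0 : 0 ≤ t) (ht1 : t ≤ 1) :
    Φ (fun i => geomMean t (X i) (A i)) ≤ geomMean t (Φ X) (Φ A) := by
  choose μ R hμ hR hRX hRA hgm using fun i => exists_geomMean_resolution (hX i) (hA i)
  have h := sum_rpow_smul_le_geomMean (R := fun J : Fin n → Fin q => Φ fun i => R i (J i))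
    (μ := fun J => ∏ i, μ i (J i)) ht0 ht1 (map_posDef hpos hunital hX)
    (map_posDef hpos hunital hA) (fun J => map_nonneg hpos fun i => hR i _)
    (fun J => Finset.prod_pos fun i _ => hμ i _)
    (by rw [← MultilinearMap.map_sum]; simp only [hRX])
    (by rw [← map_sum_smul]; simp only [hRA]; exact le_rfl)
  refine le_of_eq_of_le ?_ h
  simp only [hgm]
  rw [map_sum_smul Φ (fun i j => μ i j ^ t) R]
  refine Finset.sum_congr rfl fun J _ => ?_
  rw [Real.finsetProd_rpow _ _ fun i _ => (hμ i _).le]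

/-! ### Information monotonicity of power means -/

theorem isWeight_prodWeight {ω : Fin n → Fin k → ℝ} (hω : ∀ i, IsWeight (ω i)) :
    IsWeight (prodWeight ω) := by
  refine ⟨fun J => Finset.prod_nonneg fun i _ => (hω i).1 _, ?_⟩
  have h := Finset.prod_univ_sum (fun _ : Fin n => (Finset.univ : Finset (Fin k))) ω
  rw [Fintype.piFinset_univ] at h
  simp only [prodWeight, ← h, (hω _).2, Finset.prod_const_one]

/-- The image under `Φ` of solutions of power mean equations is a subsolution of the power mean
equation for the product data. -/
theorem map_le_powerMeanMap (hpos : IsPositiveMultilinear Φ) (hunital : IsUnitalMultilinear Φ)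
    {ω : Fin n → Fin k → ℝ} (hω : ∀ i, IsWeight (ω i)) {A : Fin n → Fin k → CMat q}
    (hA : ∀ i j, (A i j).PosDef) {t : ℝ} (ht0 : 0 ≤ t) (ht1 : t ≤ 1) {X : Fin n → CMat q}
    (hX : ∀ i, IsPowerMeanSolution t (ω i) (A i) (X i)) :
    Φ X ≤ powerMeanMap t (prodWeight ω) (mapTuple Φ A) (Φ X) := by
  have hΦX : Φ X = ∑ J : Fin n → Fin k, prodWeight ω J •
      Φ (fun i => geomMean t (X i) (A i (J i))) := by
    unfold prodWeight
    rw [← map_sum_smul Φ ω fun i j => geomMean t (X i) (A i j)]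
    congr 1
    exact funext fun i => (hX i).2
  rw [powerMeanMap]
  refine le_of_eq_of_le hΦX (Finset.sum_le_sum fun J _ => ?_)
  exact smul_le_smul_of_nonneg_left
    (map_geomMean_le hpos hunital (fun i => (hX i).1) (fun i => hA i _) ht0 ht1)
    ((isWeight_prodWeight hω).1 J)

end CMat

theorem mainTheorem11 {n k q p : ℕ}
    (Φ : MultilinearMap ℂ (fun _ : Fin n => CMat q) (CMat p))
    (hpos : IsPositiveMultilinear Φ) (hunital : IsUnitalMultilinear Φ)
    (ω : Fin n → Fin k → ℝ) (hω : ∀ i, IsWeight (ω i))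
    (A : Fin n → Fin k → CMat q) (hA : ∀ i j, (A i j).PosDef) :
    (∀ t : ℝ, 0 < t → t ≤ 1 →
      Φ (fun i => powerMean t (ω i) (A i)) ≤ powerMean t (prodWeight ω) (mapTuple Φ A)) ∧
    (∀ t : ℝ, -1 ≤ t → t < 0 → ∀ m M : ℝ, 0 < m → m < M →
      (∀ i j, m • (1 : CMat q) ≤ A i j ∧ A i j ≤ M • (1 : CMat q)) →
      powerMean t (prodWeight ω) (mapTuple Φ A) ≤
        ((M ^ n + m ^ n) ^ 2 / (4 * M ^ n * m ^ n)) •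
          Φ (fun i => powerMean t (ω i) (A i))) := by
  have hw := CMat.isWeight_prodWeight hω
  have hB : ∀ J, (mapTuple Φ A J).PosDef := fun J => CMat.map_posDef hpos hunital fun i => hA i _
  refine ⟨fun t ht0 ht1 => ?_, fun t ht1 ht0 m M hm hmM hmA => ?_⟩
  · simp only [powerMean, if_pos ht0]
    have hX := fun i => CMat.powerMeanPos_spec ht0.le ht1 (hω i) (hA i)
    exact CMat.le_of_le_powerMeanMap ht0 ht1 hw hB (CMat.powerMeanPos_spec ht0.le ht1 hw hB)
      (CMat.map_posDef hpos hunital fun i => (hX i).1)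
      (CMat.map_le_powerMeanMap hpos hunital hω hA ht0.le ht1 hX)
  · simp only [powerMean, if_neg ht0.not_gt]
    have hs0 : 0 < -t := neg_pos.2 ht0
    have hs1 : -t ≤ 1 := neg_le.1 ht1
    generalize -t = s at hs0 hs1
    have hM : 0 < M := hm.trans hmM
    set K : ℝ := (M ^ n + m ^ n) ^ 2 / (4 * M ^ n * m ^ n) with hK
    have hK0 : 0 < K := by positivity
    have hA' : ∀ i j, ((A i j)⁻¹).PosDef := fun i j => (hA i j).inv
    have hX := fun i => CMat.powerMeanPos_spec hs0.le hs1 (hω i) (hA' i)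
    have hQ := CMat.powerMeanPos_spec hs0.le hs1 hw fun J => (hB J).inv
    set X : Fin n → CMat q := fun i => powerMeanPos s (ω i) fun j => (A i j)⁻¹
    have hΦX : (Φ X).PosDef := CMat.map_posDef hpos hunital fun i => (hX i).1
    have hΦA' : ∀ J, (mapTuple Φ (fun i j => (A i j)⁻¹) J).PosDef :=
      fun J => CMat.map_posDef hpos hunital fun i => hA' i _
    -- `K⁻¹ Φ(X)` is a subsolution for the data `Φ(A)⁻¹`, as these dominate `K⁻¹ Φ(A⁻¹)` by the
    -- Kantorovich inequality.
    have hsub : K⁻¹ • Φ X ≤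
        powerMeanMap s (prodWeight ω) (fun J => (mapTuple Φ A J)⁻¹) (K⁻¹ • Φ X) := by
      have h1 := smul_le_smul_of_nonneg_left
        (CMat.map_le_powerMeanMap hpos hunital hω hA' hs0.le hs1 hX) (inv_nonneg.2 hK0.le)
      refine h1.trans ?_
      rw [powerMeanMap, Finset.smul_sum]
      refine Finset.sum_le_sum fun J _ => ?_
      rw [smul_comm]
      refine smul_le_smul_of_nonneg_left ?_ (hw.1 J)
      have h2 := CMat.smul_geomMean_le hΦX (hΦA' J) hs0.le hs1 (inv_pos.2 hK0) (inv_pos.2 hK0)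
      rw [← Real.rpow_add (inv_pos.2 hK0), sub_add_cancel, Real.rpow_one] at h2
      refine h2.trans (CMat.geomMean_mono_right (CMat.posDef_smul hΦX (inv_pos.2 hK0))
        (CMat.posDef_smul (hΦA' J) (inv_pos.2 hK0)) ?_ hs0.le hs1)
      rw [inv_smul_le_iff_of_pos hK0]
      exact CMat.map_inv_le_smul_inv_map hpos hunital (fun i => hA i (J i)) hm hM
        (fun i => (hmA i _).1) fun i => (hmA i _).2
    have hle := CMat.le_of_le_powerMeanMap hs0 hs1 hw (fun J => (hB J).inv) hQ
      (CMat.posDef_smul hΦX (inv_pos.2 hK0)) hsub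
    refine (CMat.inv_le_inv (CMat.posDef_smul hΦX (inv_pos.2 hK0)) hle).trans ?_
    have hinv : (K⁻¹ • Φ X)⁻¹ = K • (Φ X)⁻¹ := by
      apply Matrix.inv_eq_right_inv
      rw [smul_mul_smul_comm, inv_mul_cancel₀ hK0.ne', one_smul,
        Matrix.mul_nonsing_inv _ ((Matrix.isUnit_iff_isUnit_det _).1 hΦX.isUnit)]
    rw [hinv]
    exact smul_le_smul_of_nonneg_left
      (CMat.inv_map_le_map_inv hpos hunital fun i => (hX i).1) hK0.le
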